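/- Let $\mathcal{O}(\overline{D(0,1)}) \subset \mathbf{C}[[z]]$ denote the ring of power series that are Taylor series at $0$ of functions holomorphic on some open neighborhood of the closed unit disc $|z| \le 1$. Let $\mathbf{T} = \{ e^{2\pi i \theta} : \theta \in [0,1)\}$ be the unit circle with its normalized Haar measure $\mu_{\mathrm{Haar}} = d\theta$, and write $\log^+ r = \max(0, \log r)$, with $\log^+ 0 = 0$. Consider the following data: (i) a nonconstant rational function $p(x) \in \mathbf{Q}(x) \setminus \mathbf{Q}$ without pole at $x = 0$; (ii) a formal power series $x(t) \in t + t^2 \mathbf{Q}[[t]]$ such that $p(x(t)) \in \mathbf{Z}[[t]]$; (iii) a function $\varphi$ holomorphic on a neighborhood of the closed unit disc, with $\varphi(0) = 0$ and $|\varphi'(0)| > 1$, such that $p \circ \varphi$ is holomorphic on a neighborhood of the closed unit disc. Let $f_1, \ldots, f_m \in \mathbf{Q}[[x]]$ be formal power series that are linearly independent over the field $\mathbf{Q}(p(x))$ and such that, for every $i$, the formal composition $f_i(x(t))$ lies in $\mathbf{Z}[[t]]$ and the formal composition $f_i(\varphi(z))$ of $f_i$ with the Taylor series of $\varphi$ at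 $0$ lies in $\mathcal{O}(\overline{D(0,1)})$. Then $f_1, \ldots, f_m$ are all algebraic over $\mathbf{Q}(x)$, and $$ m \;\le\; e \cdot \frac{\int_{\mathbf{T}} \log^+ |p \circ \varphi| \, \mu_{\mathrm{Haar}}}{\log |\varphi'(0)|}, $$ where $e = 2.718\ldots$ is the base of the natural logarithm. -/

import Mathlib

open scoped PowerSeries LaurentSeries

/-- The Taylor series at `0` of a function `g : ℂ → ℂ`, as a formal power series. -/
noncomputable def taylorSeries (g : ℂ → ℂ) : ℂ⟦X⟧ :=
  PowerSeries.mk fun n => iteratedDeriv n g 0 / (n.factorial : ℂ)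

/-- Membership of a formal power series in `𝒪(closed unit disc) ⊆ ℂ⟦z⟧`: it is the Taylor series
at `0` of a function that is holomorphic on a neighbourhood of the closed unit disc. -/
def IsHolomorphicOnClosedDisc (F : ℂ⟦X⟧) : Prop :=
  ∃ g : ℂ → ℂ, AnalyticOnNhd ℂ g (Metric.closedBall 0 1) ∧ taylorSeries g = F

/-- A power series over `ℚ` all of whose coefficients are integers. -/
def HasIntegerCoeffs (F : ℚ⟦X⟧) : Prop :=
  ∀ n : ℕ, ∃ k : ℤ, PowerSeries.coeff n F = (k : ℚ)

/-! This is a transcendence argument in `d` variables, with `d` large. The `m * D` series `f_i p^k`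
with `k < D` are independent over `ℚ`, and so are their `d`-fold tensor products. A Siegel lemma for
real forms gives a nonzero integer combination, with small coefficients, whose pullback by `φ` in
each variable, multiplied by a weight `exp (-D Q(z_s))`, has tiny Taylor coefficients in total
degree below `α`.

In lowest total degree a change of variable acts on coefficients through its diagonal only. Through
`x(t)` the diagonal is `1`, so a nonzero lowest coefficient is a nonzero integer. Through `φ` it is
multiplied by a number of absolute value `|φ'(0)|^|n| * exp (-d D Re Q(0))`. Tiny coefficients
cannot be that large, so the order of vanishing is at least `α`. Cauchy's estimate on the unit
circle then bounds the leading coefficient from above (`pow_le_of_small_tensorCoeff`).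

The weight is chosen so that `Re Q` majorizes `log⁺ |p ∘ φ|` on the circle while `Re Q(0)` is nearly
its mean. All weighted functions are then bounded independently of `k` and `D`. There are about `α^d
/ d!` conditions for `(m D)^d` unknowns, so `α` can be close to `(d / e) m D`. This is the source of
the constant `e`. Letting `D`, then `d`, be large gives the bound (`card_mul_log_le`).

Algebraicity follows by applying the bound to the powers of one `f_i`: if `f_i` were transcendental,
arbitrarily many of them would be independent. -/

/-! ### Tensor powers of a finite family of sequences -/

/-- The coefficient at the multi-index `n` of the linear combination `∑ j, a j • ⨂ s, b (j s)` of
pure tensors built from the sequences `b i`. -/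
def tensorCoeff {R ι : Type*} [CommRing R] [Fintype ι] {d : ℕ} (b : ι → ℕ → R)
    (a : (Fin d → ι) → R) (n : Fin d → ℕ) : R :=
  ∑ j, a j * ∏ s, b (j s) (n s)

/-- The lower triangular transform of a sequence. -/
def lowerTransform {R : Type*} [CommRing R] (τ : ℕ → ℕ → R) (b : ℕ → R) (n : ℕ) : R :=
  ∑ l ∈ Finset.range (n + 1), τ n l * b l

theorem tensorCoeff_lowerTransform {R ι : Type*} [CommRing R] [Fintype ι] {d : ℕ}
    (b : ι → ℕ → R) (a : (Fin d → ι) → R) (τ : ℕ → ℕ → R) (n : Fin d → ℕ) :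
    tensorCoeff (fun i => lowerTransform τ (b i)) a n =
      ∑ l ∈ Fintype.piFinset (fun s => Finset.range (n s + 1)),
        (∏ s, τ (n s) (l s)) * tensorCoeff b a l := by
  simp only [tensorCoeff, lowerTransform, Finset.prod_univ_sum, Finset.mul_sum]
  rw [Finset.sum_comm]
  refine Finset.sum_congr rfl fun l _ => Finset.sum_congr rfl fun j _ => ?_
  rw [Finset.prod_mul_distrib]
  ring

/-- At a multi-index below which all coefficients vanish, a triangular transform acts through its
diagonal. -/
theorem tensorCoeff_lowerTransform_of_minimal {R ι : Type*} [CommRing R] [Fintype ι] {d : ℕ}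
    (b : ι → ℕ → R) (a : (Fin d → ι) → R) (τ : ℕ → ℕ → R) (n : Fin d → ℕ)
    (hn : ∀ l : Fin d → ℕ, ∑ s, l s < ∑ s, n s → tensorCoeff b a l = 0) :
    tensorCoeff (fun i => lowerTransform τ (b i)) a n =
      (∏ s, τ (n s) (n s)) * tensorCoeff b a n := by
  rw [tensorCoeff_lowerTransform]
  refine Finset.sum_eq_single n (fun l hl hne => ?_) (fun h => ?_)
  · rw [hn l, mul_zero]
    have hle : ∀ s, l s ≤ n s := fun s => by
      have := Fintype.mem_piFinset.1 hl s
      simpa [Nat.lt_succ_iff] using this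
    obtain ⟨s, hs⟩ := Function.ne_iff.1 hne
    exact Finset.sum_lt_sum (fun s _ => hle s) ⟨s, Finset.mem_univ _, lt_of_le_of_ne (hle s) hs⟩
  · exact absurd (Fintype.mem_piFinset.2 fun s => by simp) h

theorem tensorCoeff_map {R S ι : Type*} [CommRing R] [CommRing S] [Fintype ι] {d : ℕ} (g : R →+* S)
    (b : ι → ℕ → R) (a : (Fin d → ι) → R) (n : Fin d → ℕ) :
    tensorCoeff (fun i l => g (b i l)) (fun j => g (a j)) n = g (tensorCoeff b a n) := by
  simp [tensorCoeff]

/-- Tensor powers of a linearly independent family of sequences are linearly independent. -/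
theorem exists_tensorCoeff_ne_zero {R ι : Type*} [CommRing R] [Fintype ι] {b : ι → ℕ → R}
    (hb : LinearIndependent R b) :
    ∀ {d : ℕ} {a : (Fin d → ι) → R}, a ≠ 0 → ∃ n, tensorCoeff b a n ≠ 0 := by
  intro d
  induction d with
  | zero =>
    intro a ha
    refine ⟨0, fun h => ha ?_⟩
    ext j
    have hj : j = default := Subsingleton.elim _ _
    simpa [tensorCoeff, hj] using h
  | succ d ih =>
    intro a ha
    by_contra! h
    apply ha
    -- With the last `d` indices frozen at `n`, the vanishing tensor is a linear relation among the
    -- sequences `b i` in the first variable.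
    have key : ∀ (n : Fin d → ℕ) (i : ι),
        tensorCoeff b (fun j : Fin d → ι => a (Fin.cons i j)) n = 0 := by
      intro n
      refine Fintype.linearIndependent_iff.1 hb _ ?_
      ext k
      have := h (Fin.cons k n)
      rw [tensorCoeff, ← (Fin.consEquiv fun _ => ι).sum_comp, Fintype.sum_prod_type] at this
      simp only [Fin.consEquiv_apply, Fin.prod_univ_succ, Fin.cons_zero, Fin.cons_succ] at this
      rw [Finset.sum_apply, Pi.zero_apply, ← this]
      refine Finset.sum_congr rfl fun i _ => ?_
      rw [Pi.smul_apply, smul_eq_mul, tensorCoeff, Finset.sum_mul]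
      refine Finset.sum_congr rfl fun j _ => ?_
      rw [show (Fin.consEquiv fun _ => ι) (i, j) = Fin.cons i j from rfl]
      ring
    ext j
    by_contra hj
    have : (fun j' : Fin d → ι => a (Fin.cons (j 0) j')) ≠ 0 := fun h0 => hj <| by
      simpa [Fin.cons_self_tail] using congrFun h0 (Fin.tail j)
    obtain ⟨n, hn⟩ := ih this
    exact hn (key n (j 0))

theorem norm_tensorCoeff_le {ι : Type*} [Fintype ι] {d : ℕ} {b : ι → ℕ → ℂ}
    {a : (Fin d → ι) → ℂ} {C T : ℝ} (hb : ∀ i n, ‖b i n‖ ≤ C) (ha : ∀ j, ‖a j‖ ≤ T)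
    (n : Fin d → ℕ) : ‖tensorCoeff b a n‖ ≤ (Fintype.card ι : ℝ) ^ d * (T * C ^ d) := by
  refine (norm_sum_le_of_le (f := fun j => a j * ∏ s, b (j s) (n s)) (n := fun _ => T * C ^ d)
    Finset.univ fun j _ => ?_).trans (le_of_eq ?_)
  · rw [norm_mul, norm_prod]
    refine mul_le_mul (ha j) ?_ (Finset.prod_nonneg fun _ _ => norm_nonneg _)
      ((norm_nonneg _).trans (ha j))
    refine (Finset.prod_le_prod (fun _ _ => norm_nonneg _) fun s _ => hb (j s) (n s)).trans ?_
    simp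
  · simp

/-- Extrapolation: integrality bounds the leading coefficient of an auxiliary function from below,
and if its low order coefficients are small in the complex transform, they vanish. -/
theorem pow_le_of_small_tensorCoeff {ι : Type*} [Fintype ι] {b : ι → ℕ → ℚ}
    (hb : LinearIndependent ℚ b) {σ : ℕ → ℕ → ℚ} (hσ : ∀ n, σ n n = 1)
    (hint : ∀ i n, ∃ k : ℤ, lowerTransform σ (b i) n = k)
    {τ : ℕ → ℕ → ℂ} {ρ w C T : ℝ} (hρ : 1 ≤ ρ) (hw : 0 < w) (hτ : ∀ n, ‖τ n n‖ = ρ ^ n * w)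
    (hC : ∀ i n, ‖lowerTransform τ (fun l => (b i l : ℂ)) n‖ ≤ C)
    {d α : ℕ} {a : (Fin d → ι) → ℤ} (ha : a ≠ 0) (haT : ∀ j, |(a j : ℝ)| ≤ T)
    (hsmall : ∀ n : Fin d → ℕ, ∑ s, n s < α →
      ‖tensorCoeff (fun i => lowerTransform τ (fun l => (b i l : ℂ))) (fun j => (a j : ℂ)) n‖
        < w ^ d) :
    ρ ^ α * w ^ d ≤ (Fintype.card ι : ℝ) ^ d * (T * C ^ d) := by
  classical
  have ha' : (fun j => (a j : ℚ)) ≠ 0 := fun h => ha <| by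
    ext j; simpa using congrFun h j
  have hex : ∃ N, ∃ n : Fin d → ℕ, ∑ s, n s = N ∧ tensorCoeff b (fun j => (a j : ℚ)) n ≠ 0 := by
    obtain ⟨n, hn⟩ := exists_tensorCoeff_ne_zero hb ha'
    exact ⟨_, n, rfl, hn⟩
  -- Choose `n` of least total degree with nonzero coefficient, so that only diagonals matter below.
  obtain ⟨n, hnN, hn⟩ := Nat.find_spec hex
  have hmin : ∀ l : Fin d → ℕ, ∑ s, l s < ∑ s, n s →
      tensorCoeff b (fun j => (a j : ℚ)) l = 0 := by
    intro l hl
    by_contra h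
    exact Nat.find_min hex (hnN ▸ hl) ⟨l, rfl, h⟩
  -- The unipotent transform `σ` preserves this coefficient and makes it an integer.
  have hone : 1 ≤ ‖((tensorCoeff b (fun j => (a j : ℚ)) n : ℚ) : ℂ)‖ := by
    have h1 := tensorCoeff_lowerTransform_of_minimal b _ σ n hmin
    choose k hk using hint
    have h2 : tensorCoeff (fun i => lowerTransform σ (b i)) (fun j => (a j : ℚ)) n =
        ((tensorCoeff k a n : ℤ) : ℚ) := by
      have h3 := tensorCoeff_map (Int.castRingHom ℚ) k a n
      simp only [eq_intCast] at h3
      rw [← h3]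
      congr
      ext i l
      exact hk i l
    simp only [hσ, Finset.prod_const_one, one_mul] at h1
    rw [← h1, h2] at hn ⊢
    have : tensorCoeff k a n ≠ 0 := by exact_mod_cast hn
    rw [Rat.cast_intCast, Complex.norm_intCast]
    exact_mod_cast Int.one_le_abs this
  have hmin' : ∀ l : Fin d → ℕ, ∑ s, l s < ∑ s, n s →
      tensorCoeff (fun i l => (b i l : ℂ)) (fun j => (a j : ℂ)) l = 0 := by
    intro l hl
    have := tensorCoeff_map (Rat.castHom ℂ) b (fun j => (a j : ℚ)) l
    rw [hmin l hl, map_zero] at this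
    simpa using this
  have hval : tensorCoeff (fun i l => (b i l : ℂ)) (fun j => (a j : ℂ)) n =
      ((tensorCoeff b (fun j => (a j : ℚ)) n : ℚ) : ℂ) := by
    simpa using tensorCoeff_map (Rat.castHom ℂ) b (fun j => (a j : ℚ)) n
  have hlow : ρ ^ (∑ s, n s) * w ^ d ≤
      ‖tensorCoeff (fun i => lowerTransform τ (fun l => (b i l : ℂ))) (fun j => (a j : ℂ)) n‖ := by
    rw [tensorCoeff_lowerTransform_of_minimal _ _ τ n hmin', hval, norm_mul, norm_prod]
    simp only [hτ, Finset.prod_mul_distrib, Finset.prod_pow_eq_pow_sum, Finset.prod_const,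
      Finset.card_univ, Fintype.card_fin]
    exact le_mul_of_one_le_right (by positivity) hone
  have hα : α ≤ ∑ s, n s := by
    by_contra! h
    have := (hlow.trans_lt (hsmall n h))
    have h1 : (1 : ℝ) ≤ ρ ^ (∑ s, n s) := one_le_pow₀ hρ
    nlinarith [pow_pos hw d]
  calc ρ ^ α * w ^ d ≤ ρ ^ (∑ s, n s) * w ^ d := by gcongr
    _ ≤ _ := hlow
    _ ≤ _ := norm_tensorCoeff_le hC (fun j => by simpa using haT j) n

/-! ### Small values of real linear forms at integer points -/

/-- A version of Siegel's lemma for real linear forms. -/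
theorem exists_int_vec_small_linear_forms {α β : Type*} [Fintype α] [Fintype β]
    (A : α → β → ℝ) {K S : ℝ} (hA : ∀ i j, |A i j| ≤ K) (hS : 0 < S) (hSK : 1 ≤ S * K)
    (hlt : Fintype.card α < Fintype.card β) (hpos : 0 < Fintype.card α) {e : ℝ}
    (he : (Fintype.card α : ℝ) / (Fintype.card β - Fintype.card α) ≤ e) :
    ∃ a : β → ℤ, a ≠ 0 ∧ (∀ j, |(a j : ℝ)| ≤ (Fintype.card β * (2 * (S * K))) ^ e) ∧
      ∀ i, |∑ j, A i j * a j| ≤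
        Fintype.card β * (Fintype.card β * (2 * (S * K))) ^ e / S := by
  classical
  -- Siegel's lemma is applied to the rounded forms `S * A`; an exact zero of these is a zero of `A`
  -- up to an error of order `1 / S`.
  let Y : Matrix α β ℤ := fun i j => round (S * A i j)
  have hY : ∀ i j, |S * A i j - Y i j| ≤ 1 / 2 := fun i j => abs_sub_round _
  let _ := Matrix.seminormedAddCommGroup (m := α) (n := β) (α := ℤ)
  obtain ⟨a, ha0, hYa, han⟩ := Int.Matrix.exists_ne_zero_int_vec_norm_le Y hlt hpos
  have hcard : (1 : ℝ) ≤ Fintype.card β := by exact_mod_cast (Nat.zero_le _).trans_lt hlt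
  have hYn : max 1 ‖Y‖ ≤ 2 * (S * K) := by
    refine max_le (by linarith) ((Matrix.norm_le_iff (by linarith)).2 fun i j => ?_)
    rw [Int.norm_eq_abs]
    have h1 := abs_le.1 (hY i j)
    have h2 : |S * A i j| ≤ S * K := by
      rw [abs_mul, abs_of_pos hS]; exact mul_le_mul_of_nonneg_left (hA i j) hS.le
    have h3 := abs_le.1 h2
    exact abs_le.2 ⟨by linarith, by linarith⟩
  set T : ℝ := (Fintype.card β * (2 * (S * K))) ^ e with hT
  have hT0 : 0 ≤ T := by positivity
  have haT : ∀ j, |(a j : ℝ)| ≤ T := by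
    intro j
    have h1 : ‖a j‖ ≤ ‖a‖ := norm_le_pi_norm a j
    rw [Int.norm_eq_abs] at h1
    refine (h1.trans han).trans ?_
    refine (Real.rpow_le_rpow_of_exponent_le ?_ he).trans
      (Real.rpow_le_rpow (by positivity) (by gcongr) ?_)
    · exact one_le_mul_of_one_le_of_one_le hcard (le_max_left _ _)
    · refine le_trans (div_nonneg (by positivity) ?_) he
      have : (Fintype.card α : ℝ) < Fintype.card β := by exact_mod_cast hlt
      linarith
  refine ⟨a, ha0, haT, fun i => ?_⟩
  have h0 : ∑ j, (Y i j : ℝ) * a j = 0 := by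
    have := congrFun hYa i
    simp only [Matrix.mulVec, dotProduct, Pi.zero_apply] at this
    exact_mod_cast this
  have h1 : S * ∑ j, A i j * a j = ∑ j, (S * A i j - Y i j) * a j := by
    simp only [sub_mul, Finset.sum_sub_distrib, h0, sub_zero, Finset.mul_sum, mul_assoc]
  have h2 : |S * ∑ j, A i j * a j| ≤ Fintype.card β * T := by
    rw [h1]
    refine (Finset.abs_sum_le_sum_abs _ _).trans ?_
    refine (Finset.sum_le_card_nsmul _ _ T fun j _ => ?_).trans (by simp)
    rw [abs_mul]
    calc |S * A i j - Y i j| * |(a j : ℝ)| ≤ 1 / 2 * T :=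
          mul_le_mul (hY i j) (haT j) (abs_nonneg _) (by norm_num)
      _ ≤ T := by linarith
  rw [abs_mul, abs_of_pos hS] at h2
  rw [le_div_iff₀ hS]
  linarith

/-! ### The auxiliary construction and its asymptotics -/

/-- The multi-indices of total degree less than `α`. -/
def lowDegree (d α : ℕ) : Finset (Fin d → ℕ) :=
  -- Coordinate `0` is a slack variable raising the degree to exactly `α - 1`. For `α = 0` truncated
  -- subtraction leaves the zero index, which is harmless for the inclusion and the cardinality
  -- bound used.
  ((Finset.univ : Finset (Fin (d + 1))).piAntidiag (α - 1)).image Fin.tail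

theorem mem_lowDegree {d α : ℕ} {n : Fin d → ℕ} (hn : ∑ s, n s < α) : n ∈ lowDegree d α := by
  refine Finset.mem_image.2 ⟨Fin.cons (α - 1 - ∑ s, n s) n, ?_, Fin.tail_cons _ _⟩
  simp only [Finset.mem_piAntidiag, Finset.mem_univ, implies_true, and_true]
  rw [Fin.sum_univ_succ]
  simp only [Fin.cons_zero, Fin.cons_succ]
  omega

theorem card_lowDegree_le (d α : ℕ) :
    ((lowDegree d α).card : ℝ) ≤ ((α + d : ℕ) : ℝ) ^ d / d.factorial := by
  have h1 : (lowDegree d α).card ≤ (α - 1 + d).choose d := by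
    refine Finset.card_image_le.trans (le_of_eq ?_)
    rw [← Finset.map_sym_eq_piAntidiag, Finset.card_map, Finset.sym_univ, Finset.card_univ,
      Sym.card_sym_eq_choose, Fintype.card_fin]
    rw [show d + 1 + (α - 1) - 1 = α - 1 + d by omega]
    exact Nat.choose_symm_add
  calc ((lowDegree d α).card : ℝ) ≤ ((α - 1 + d).choose d : ℕ) := by exact_mod_cast h1
    _ ≤ ((α + d).choose d : ℕ) := by exact_mod_cast Nat.choose_le_choose d (by omega)
    _ ≤ _ := by exact_mod_cast Nat.choose_le_pow_div d (α + d)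

/-- The inequality obtained from an auxiliary function in `d` variables vanishing to order `α`. -/
theorem pow_le_of_siegel {ι : Type*} [Fintype ι] {b : ι → ℕ → ℚ}
    (hb : LinearIndependent ℚ b) {σ : ℕ → ℕ → ℚ} (hσ : ∀ n, σ n n = 1)
    (hint : ∀ i n, ∃ k : ℤ, lowerTransform σ (b i) n = k)
    {τ : ℕ → ℕ → ℂ} {ρ w C : ℝ} (hρ : 1 ≤ ρ) (hw : 0 < w) (hτ : ∀ n, ‖τ n n‖ = ρ ^ n * w)
    (hC1 : 1 ≤ C) (hC : ∀ i n, ‖lowerTransform τ (fun l => (b i l : ℂ)) n‖ ≤ C)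
    {d α : ℕ} (hα : 0 < α) [Nonempty ι] {κ S : ℝ} (hκ : κ ≤ 1 / 2) (hS : 1 ≤ S)
    (hcard : 2 * (((α + d : ℕ) : ℝ) ^ d / d.factorial) ≤ κ * (Fintype.card ι : ℝ) ^ d)
    (hsmall : 2 * ((Fintype.card ι : ℝ) ^ d *
      ((Fintype.card ι : ℝ) ^ d * (2 * (S * C ^ d))) ^ (2 * κ) / S) < w ^ d) :
    ρ ^ α * w ^ d ≤ (Fintype.card ι : ℝ) ^ d *
      (((Fintype.card ι : ℝ) ^ d * (2 * (S * C ^ d))) ^ (2 * κ) * C ^ d) := by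
  classical
  have hcβ : (Fintype.card (Fin d → ι) : ℝ) = (Fintype.card ι : ℝ) ^ d := by simp
  have hβ : (0 : ℝ) < (Fintype.card ι : ℝ) ^ d := by
    have : 0 < Fintype.card ι := Fintype.card_pos
    positivity
  let B : (Fin d → ℕ) → (Fin d → ι) → ℂ := fun n j =>
    ∏ s, lowerTransform τ (fun l => (b (j s) l : ℂ)) (n s)
  have hB : ∀ n j, ‖B n j‖ ≤ C ^ d := fun n j => by
    simp only [B]
    rw [norm_prod]
    refine (Finset.prod_le_prod (fun _ _ => norm_nonneg _) fun s _ => hC (j s) (n s)).trans ?_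
    simp
  -- Each complex condition is split into its real and imaginary parts, whence the factor `2` in
  -- `hcard`.
  let A : (lowDegree d α ⊕ lowDegree d α) → (Fin d → ι) → ℝ :=
    Sum.elim (fun n j => (B n j).re) (fun n j => (B n j).im)
  have hA : ∀ i j, |A i j| ≤ C ^ d := by
    rintro (n | n) j
    · exact (Complex.abs_re_le_norm _).trans (hB _ _)
    · exact (Complex.abs_im_le_norm _).trans (hB _ _)
  have hcα : (Fintype.card (lowDegree d α ⊕ lowDegree d α) : ℝ) ≤
      κ * (Fintype.card (Fin d → ι) : ℝ) := by
    rw [hcβ]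
    refine le_trans ?_ hcard
    have := card_lowDegree_le d α
    simp only [Fintype.card_sum, Fintype.card_coe]
    push_cast at this ⊢
    linarith
  have hpos : 0 < Fintype.card (lowDegree d α ⊕ lowDegree d α) := by
    have : (0 : Fin d → ℕ) ∈ lowDegree d α := mem_lowDegree (by simpa using hα)
    exact Fintype.card_pos_iff.2 ⟨Sum.inl ⟨0, this⟩⟩
  have hlt' : (Fintype.card (lowDegree d α ⊕ lowDegree d α) : ℝ) ≤
      Fintype.card (Fin d → ι) / 2 := hcα.trans (by rw [hcβ]; nlinarith)
  have hlt : Fintype.card (lowDegree d α ⊕ lowDegree d α) < Fintype.card (Fin d → ι) := by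
    have : (Fintype.card (lowDegree d α ⊕ lowDegree d α) : ℝ) < Fintype.card (Fin d → ι) := by
      rw [hcβ] at hlt' ⊢; linarith
    exact_mod_cast this
  -- The Siegel exponent is at most `κ / (1 - κ)`, hence at most `2 * κ` since `κ ≤ 1 / 2`.
  have he : (Fintype.card (lowDegree d α ⊕ lowDegree d α) : ℝ) /
      (Fintype.card (Fin d → ι) - Fintype.card (lowDegree d α ⊕ lowDegree d α)) ≤ 2 * κ := by
    have hp : (0 : ℝ) < Fintype.card (lowDegree d α ⊕ lowDegree d α) := by exact_mod_cast hpos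
    rw [div_le_iff₀ (by linarith)]
    have hκ0 : 0 ≤ κ := by
      by_contra! h
      rw [hcβ] at hcα
      nlinarith
    nlinarith
  obtain ⟨a, ha0, haT, hasmall⟩ := exists_int_vec_small_linear_forms A hA (by linarith : 0 < S)
    (one_le_mul_of_one_le_of_one_le hS (one_le_pow₀ hC1)) hlt hpos he
  rw [hcβ] at haT hasmall
  refine pow_le_of_small_tensorCoeff hb hσ hint hρ hw hτ hC ha0 haT fun n hn => ?_
  have hn' := mem_lowDegree hn
  have hre := hasmall (Sum.inl ⟨n, hn'⟩)
  have him := hasmall (Sum.inr ⟨n, hn'⟩)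
  refine lt_of_le_of_lt ?_ hsmall
  refine (Complex.norm_le_abs_re_add_abs_im _).trans ?_
  rw [two_mul]
  refine add_le_add (le_trans (le_of_eq ?_) hre) (le_trans (le_of_eq ?_) him)
  · simp [tensorCoeff, A, B, Complex.re_sum, mul_comm]
  · simp [tensorCoeff, A, B, Complex.im_sum, mul_comm]

theorem tendsto_log_mul_div_atTop (m : ℝ) :
    Filter.Tendsto (fun D : ℕ => Real.log (m * D) / D) Filter.atTop (nhds 0) := by
  have h1 : Filter.Tendsto (fun D : ℕ => Real.log D / D) Filter.atTop (nhds 0) := by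
    have := Real.isLittleO_log_id_atTop.tendsto_div_nhds_zero
    exact this.comp tendsto_natCast_atTop_atTop
  have h2 : Filter.Tendsto (fun D : ℕ => Real.log m / D) Filter.atTop (nhds 0) :=
    tendsto_const_div_atTop_nhds_zero_nat _
  rcases eq_or_ne m 0 with rfl | hm
  · simp
  have h3 := h2.add h1
  rw [add_zero] at h3
  refine h3.congr' ?_
  filter_upwards [Filter.eventually_gt_atTop 0] with D hD
  rw [Real.log_mul hm (by positivity), add_div]

/-- The logarithmic form of `pow_le_of_siegel` for `m * D` functions. -/
theorem mul_log_le_of_siegel {ι : Type*} [Fintype ι] {b : ι → ℕ → ℚ}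
    (hb : LinearIndependent ℚ b) {σ : ℕ → ℕ → ℚ} (hσ : ∀ n, σ n n = 1)
    (hint : ∀ i n, ∃ k : ℤ, lowerTransform σ (b i) n = k)
    {τ : ℕ → ℕ → ℂ} {ρ C v D : ℝ} (hρ : 1 ≤ ρ) (hv : 0 ≤ v) (hD : 0 ≤ D)
    (hτ : ∀ n, ‖τ n n‖ = ρ ^ n * Real.exp (-(D * v)))
    (hC1 : 1 ≤ C) (hC : ∀ i n, ‖lowerTransform τ (fun l => (b i l : ℂ)) n‖ ≤ C)
    {d α : ℕ} (hα : 0 < α) [Nonempty ι] {κ : ℝ} (hκ : κ ≤ 1 / 8)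
    (hcard : 2 * (((α + d : ℕ) : ℝ) ^ d / d.factorial) ≤ κ * (Fintype.card ι : ℝ) ^ d)
    {E : ℝ} (hE : E = d * Real.log (Fintype.card ι) + Real.log 2 + d * Real.log C)
    (hED : 2 * E < D * (3 / 4)) :
    α * Real.log ρ ≤ d * v * D + 2 * E + 2 * κ * (2 * d * v + 1) * D := by
  have hι : (1 : ℝ) ≤ Fintype.card ι := by exact_mod_cast (Fintype.card_pos : 0 < Fintype.card ι)
  set N : ℝ := (Fintype.card ι : ℝ) with hN
  have hlN : 0 ≤ Real.log N := Real.log_nonneg hι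
  have hlC : 0 ≤ Real.log C := Real.log_nonneg hC1
  have hl2 : 0 ≤ Real.log 2 := Real.log_nonneg (by norm_num)
  have hE0 : 0 ≤ E := by rw [hE]; positivity
  have hN0 : 0 < N := by linarith
  have hC0 : 0 < C := by linarith
  have hρ0 : 0 < ρ := by linarith
  -- Since `2 * κ ≤ 1 / 4`, at least three quarters of `log S` survives in `hsmall`; the coefficient
  -- `2 * d * v` then beats the `d * v * D` coming from the weight, and the extra `D` absorbs `E`.
  set S : ℝ := Real.exp ((2 * d * v + 1) * D) with hS
  have hlogU : Real.log (N ^ d * (2 * (S * C ^ d))) = E + (2 * d * v + 1) * D := by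
    rw [Real.log_mul (by positivity) (by positivity), Real.log_mul (by positivity) (by positivity),
      Real.log_mul (by positivity) (by positivity), Real.log_pow, Real.log_pow, hS, Real.log_exp,
      hE]
    ring
  have hUpos : 0 < N ^ d * (2 * (S * C ^ d)) := by positivity
  have hdN : Real.log 2 + d * Real.log N ≤ E := by
    rw [hE]; have : (0 : ℝ) ≤ d * Real.log C := by positivity
    linarith
  have hvd : (0 : ℝ) ≤ d * v * D := by positivity
  have key := pow_le_of_siegel hb hσ hint hρ (Real.exp_pos _) hτ hC1 hC hα (S := S)
    (by linarith : κ ≤ 1 / 2) (Real.one_le_exp (by positivity)) hcard ?_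
  · have h1 := Real.log_le_log (by positivity) key
    rw [Real.log_mul (by positivity) (by positivity), Real.log_mul (by positivity) (by positivity),
      Real.log_mul (by positivity) (by positivity), Real.log_pow, Real.log_pow, Real.log_pow,
      Real.log_pow, Real.log_exp, Real.log_rpow hUpos, hlogU] at h1
    have h2 : d * Real.log N + d * Real.log C ≤ E := by rw [hE]; linarith
    have h3 : 2 * κ * E ≤ E := by nlinarith
    linarith
  · refine (Real.log_lt_log_iff (by positivity) (by positivity)).1 ?_
    rw [Real.log_mul (by positivity) (by positivity), Real.log_div (by positivity) (by positivity),
      Real.log_mul (by positivity) (by positivity), Real.log_pow, Real.log_pow, Real.log_exp,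
      Real.log_rpow hUpos, hlogU, Real.log_exp]
    have h3 : 2 * κ * E ≤ E / 4 := by nlinarith
    have h4 : 2 * κ * ((2 * d * v + 1) * D) ≤ (2 * d * v + 1) * D / 4 := by
      have : 0 ≤ (2 * d * v + 1) * D := by positivity
      nlinarith
    nlinarith

/-- The number of conditions is at most `κ` times the number of unknowns. -/
theorem two_mul_pow_div_factorial_le {α d : ℕ} {η κ M : ℝ} (hη : η ≤ 1)
    (hd : (1 - η / 2) ^ d ≤ κ / 2) (hM : 0 ≤ M) (hα : α ≤ d / Real.exp 1 * (1 - η) * M)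
    (hηM : 2 * Real.exp 1 ≤ η * M) :
    2 * (((α + d : ℕ) : ℝ) ^ d / d.factorial) ≤ κ * M ^ d := by
  have he : 0 < Real.exp 1 := Real.exp_pos 1
  have hbase : ((α + d : ℕ) : ℝ) ≤ d / Real.exp 1 * (1 - η / 2) * M := by
    push_cast
    -- Half of the slack `η` absorbs the shift from `α` to `α + d`; the other half makes the ratio
    -- decay like `(1 - η / 2) ^ d`.
    have : (d : ℝ) ≤ d / Real.exp 1 * (η / 2) * M := by
      have h6 : (1 : ℝ) ≤ η / 2 * M / Real.exp 1 := by
        rw [le_div_iff₀ he]; linarith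
      calc (d : ℝ) = d * 1 := by ring
        _ ≤ d * (η / 2 * M / Real.exp 1) := by gcongr
        _ = _ := by ring
    linarith
  have hfac : (d : ℝ) ^ d / d.factorial ≤ Real.exp 1 ^ d := by
    rw [← Real.exp_nat_mul, mul_one]
    exact Real.pow_div_factorial_le_exp (d : ℝ) (by positivity) d
  have h1η : 0 ≤ 1 - η / 2 := by linarith
  calc 2 * (((α + d : ℕ) : ℝ) ^ d / d.factorial)
      ≤ 2 * ((d / Real.exp 1 * (1 - η / 2) * M) ^ d / d.factorial) := by gcongr
    _ = 2 * (((d : ℝ) ^ d / d.factorial) / Real.exp 1 ^ d * (1 - η / 2) ^ d) * M ^ d := by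
        rw [mul_pow, mul_pow, div_pow]; ring
    _ ≤ 2 * (1 * (κ / 2)) * M ^ d := by
        gcongr
        exact (div_le_one (by positivity)).2 hfac
    _ = κ * M ^ d := by ring

/-- The holonomy bound, in terms of the coefficients of the functions. -/
theorem card_mul_log_le {m : ℕ} {b : Fin m → ℕ → ℕ → ℚ}
    (hb : LinearIndependent ℚ (fun ik : Fin m × ℕ => b ik.1 ik.2))
    {σ : ℕ → ℕ → ℚ} (hσ : ∀ n, σ n n = 1)
    (hint : ∀ i k n, ∃ z : ℤ, lowerTransform σ (b i k) n = z)
    {τ : ℕ → ℕ → ℕ → ℂ} {ρ C v : ℝ} (hρ : 1 < ρ) (hv : 0 ≤ v)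
    (hτ : ∀ D n, ‖τ D n n‖ = ρ ^ n * Real.exp (-(D * v)))
    (hC : ∀ D i k n, k < D → ‖lowerTransform (τ D) (fun l => (b i k l : ℂ)) n‖ ≤ C) :
    m * Real.log ρ ≤ Real.exp 1 * v := by
  wlog hC1 : 1 ≤ C generalizing C
  · exact this (C := 1) (fun D i k n hk => (hC D i k n hk).trans (not_le.1 hC1).le) le_rfl
  by_contra! hlt
  have hlρ : 0 < Real.log ρ := Real.log_pos hρ
  have he : 0 < Real.exp 1 := Real.exp_pos 1
  have hm : 0 < m := by
    rcases Nat.eq_zero_or_pos m with rfl | h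
    · exfalso
      have : 0 ≤ Real.exp 1 * v := by positivity
      simp at hlt
      linarith
    · exact h
  have hmR : (0 : ℝ) < m := by exact_mod_cast hm
  -- The claim is `μ ≤ v`. If it fails, `η` and `κ` are chosen to cost at most a quarter of `μ - v`
  -- each; `d` is then fixed in terms of `η` and `κ`, and `D` comes last.
  set μ : ℝ := m * Real.log ρ / Real.exp 1 with hμ
  have hvμ : v < μ := by rw [hμ, lt_div_iff₀ he]; linarith
  have hμ0 : 0 < μ := by linarith
  set η : ℝ := (μ - v) / (4 * μ) with hη
  have hη0 : 0 < η := div_pos (by linarith) (by linarith)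
  have hημ : η * μ = (μ - v) / 4 := by rw [hη]; field_simp
  have hη1 : η < 1 := by rw [hη, div_lt_one (by linarith)]; linarith
  set κ : ℝ := min (1 / 8) ((μ - v) / (4 * (4 * v + 2))) with hκ
  have hκ0 : 0 < κ := lt_min (by norm_num) (div_pos (by linarith) (by linarith))
  have hκ8 : κ ≤ 1 / 8 := min_le_left _ _
  have hκv : κ * (4 * v + 2) ≤ (μ - v) / 4 := by
    have := min_le_right (1 / 8) ((μ - v) / (4 * (4 * v + 2)))
    rw [← hκ, le_div_iff₀ (by linarith)] at this
    linarith
  obtain ⟨d, hd⟩ := exists_pow_lt_of_lt_one (half_pos hκ0) (by linarith : 1 - η / 2 < 1)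
  have hd0 : 0 < d := by
    rcases Nat.eq_zero_or_pos d with rfl | h
    · rw [pow_zero] at hd; linarith
    · exact h
  have hdR : (1 : ℝ) ≤ d := by exact_mod_cast hd0
  set θ : ℝ := d / Real.exp 1 * (1 - η) with hθ
  have hθ0 : 0 < θ := mul_pos (by positivity) (by linarith)
  have hθμ : θ * (m * Real.log ρ) = d * ((1 - η) * μ) := by
    rw [hθ, hμ]; field_simp
  have hgap : 0 < θ * (m * Real.log ρ) - (d * v + 2 * κ * (2 * d * v + 1)) := by
    rw [hθμ]
    have h1 : 0 < (μ - v) / 2 := by linarith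
    have h2 : (μ - v) / 2 ≤ (1 - η) * μ - v - κ * (4 * v + 2) := by linarith
    have h3 : d * ((μ - v) / 2) ≤ d * ((1 - η) * μ - v - κ * (4 * v + 2)) := by gcongr
    have h4 : 0 < d * ((μ - v) / 2) := by positivity
    have h5 : κ * 1 ≤ κ * d := by gcongr
    linarith
  set gap : ℝ := θ * (m * Real.log ρ) - (d * v + 2 * κ * (2 * d * v + 1)) with hgapdef
  let E : ℕ → ℝ := fun D => d * Real.log (m * D) + Real.log 2 + d * Real.log C
  have hE : Filter.Tendsto (fun D : ℕ => E D / D) Filter.atTop (nhds 0) := by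
    have h1 := (tendsto_log_mul_div_atTop m).const_mul (d : ℝ)
    have h2 : Filter.Tendsto (fun D : ℕ => (Real.log 2 + d * Real.log C) / D) Filter.atTop
      (nhds 0) := tendsto_const_div_atTop_nhds_zero_nat _
    have h3 := h1.add h2
    simp only [mul_zero, add_zero] at h3
    refine h3.congr fun D => ?_
    simp only [E]
    ring
  -- For large `D`: `E` is negligible, the shift by `d` is absorbed, `α` is positive, and the
  -- rounding in `α` costs at most `gap * D / 4`.
  have hev1 := hE.eventually (gt_mem_nhds (show (0 : ℝ) < 3 / 8 by norm_num))
  have hev2 := hE.eventually (gt_mem_nhds (show (0 : ℝ) < gap / 4 by linarith))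
  have hev3 := (tendsto_natCast_atTop_atTop (R := ℝ)).eventually_ge_atTop
    (2 * Real.exp 1 / (m * η))
  have hev4 := (tendsto_natCast_atTop_atTop (R := ℝ)).eventually_ge_atTop (1 / (θ * m))
  have hev5 := (tendsto_natCast_atTop_atTop (R := ℝ)).eventually_ge_atTop
    (4 * Real.log ρ / gap)
  obtain ⟨D, h1, h2, h3, h4, h5, hDpos⟩ := (hev1.and (hev2.and (hev3.and (hev4.and
    (hev5.and (Filter.eventually_gt_atTop 0)))))).exists
  have hDR : (0 : ℝ) < D := by exact_mod_cast hDpos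
  rw [div_lt_iff₀ hDR] at h1 h2
  rw [div_le_iff₀ (by positivity)] at h3 h4 h5
  set α : ℕ := ⌊θ * m * D⌋₊ with hα
  have hα0 : 0 < α := Nat.floor_pos.2 (by linarith)
  have hαle : (α : ℝ) ≤ θ * m * D := Nat.floor_le (by positivity)
  have hαge : θ * m * D - 1 ≤ α := (Nat.sub_one_lt_floor _).le
  have : Nonempty (Fin m × Fin D) := ⟨⟨⟨0, hm⟩, ⟨0, hDpos⟩⟩⟩
  have hcardι : (Fintype.card (Fin m × Fin D) : ℝ) = m * D := by simp
  have hcard : 2 * (((α + d : ℕ) : ℝ) ^ d / d.factorial) ≤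
      κ * (Fintype.card (Fin m × Fin D) : ℝ) ^ d := by
    rw [hcardι]
    refine two_mul_pow_div_factorial_le hη1.le hd.le (by positivity) ?_ (by linarith)
    rw [hθ] at hαle
    linarith
  have hb' : LinearIndependent ℚ (fun ik : Fin m × Fin D => b ik.1 ik.2) :=
    hb.comp (fun ik : Fin m × Fin D => (ik.1, (ik.2 : ℕ))) fun x y h => by
      simp only [Prod.mk.injEq] at h
      exact Prod.ext h.1 (Fin.ext h.2)
  have key := mul_log_le_of_siegel hb' hσ (fun i => hint i.1 i.2) hρ.le hv hDR.le (hτ D) hC1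
    (fun i n => hC D i.1 i.2 n i.2.2) hα0 hκ8 hcard (E := E D) (by rw [hcardι])
    (by linarith)
  have h6 : (θ * m * D - 1) * Real.log ρ ≤ α * Real.log ρ := by gcongr
  have h7 : gap * D = θ * m * D * Real.log ρ - (d * v * D + 2 * κ * (2 * d * v + 1) * D) := by
    rw [hgapdef]; ring
  linarith

/-! ### Taylor series -/

theorem coeff_taylorSeries (g : ℂ → ℂ) (n : ℕ) :
    PowerSeries.coeff n (taylorSeries g) = iteratedDeriv n g 0 / (n.factorial : ℂ) := by
  simp [taylorSeries]

theorem constantCoeff_taylorSeries (g : ℂ → ℂ) :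
    PowerSeries.constantCoeff (taylorSeries g) = g 0 := by
  rw [← PowerSeries.coeff_zero_eq_constantCoeff_apply, coeff_taylorSeries]
  simp

theorem taylorSeries_mul {g h : ℂ → ℂ} (hg : AnalyticAt ℂ g 0) (hh : AnalyticAt ℂ h 0) :
    taylorSeries (fun z => g z * h z) = taylorSeries g * taylorSeries h := by
  ext n
  rw [coeff_taylorSeries, PowerSeries.coeff_mul, iteratedDeriv_fun_mul hg.contDiffAt hh.contDiffAt,
    Finset.Nat.sum_antidiagonal_eq_sum_range_succ_mk, Finset.sum_div]
  refine Finset.sum_congr rfl fun i hi => ?_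
  have hin : i ≤ n := Nat.lt_succ_iff.1 (Finset.mem_range.1 hi)
  rw [coeff_taylorSeries, coeff_taylorSeries, Nat.cast_choose ℂ hin]
  have := Nat.factorial_ne_zero n
  field_simp

theorem taylorSeries_const (c : ℂ) : taylorSeries (fun _ => c) = PowerSeries.C c := by
  ext n
  rw [coeff_taylorSeries, iteratedDeriv_const, PowerSeries.coeff_C]
  rcases eq_or_ne n 0 with rfl | h <;> simp [*]

theorem taylorSeries_add {g h : ℂ → ℂ} (hg : AnalyticAt ℂ g 0) (hh : AnalyticAt ℂ h 0) :
    taylorSeries (fun z => g z + h z) = taylorSeries g + taylorSeries h := by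
  ext n
  rw [coeff_taylorSeries, map_add, coeff_taylorSeries, coeff_taylorSeries,
    iteratedDeriv_fun_add hg.contDiffAt hh.contDiffAt, add_div]

theorem taylorSeries_pow {g : ℂ → ℂ} (hg : AnalyticAt ℂ g 0) (k : ℕ) :
    taylorSeries (fun z => g z ^ k) = taylorSeries g ^ k := by
  induction k with
  | zero => simpa using taylorSeries_const 1
  | succ k ih => simp only [pow_succ]; rw [taylorSeries_mul (hg.fun_pow k) hg, ih]

theorem taylorSeries_congr {g h : ℂ → ℂ} (hgh : g =ᶠ[nhds 0] h) :
    taylorSeries g = taylorSeries h := by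
  ext n
  rw [coeff_taylorSeries, coeff_taylorSeries, hgh.iteratedDeriv_eq]

theorem taylorSeries_aeval {φ : ℂ → ℂ} (hφ : AnalyticAt ℂ φ 0) (P : Polynomial ℚ) :
    taylorSeries (fun z => Polynomial.aeval (φ z) P) = Polynomial.aeval (taylorSeries φ) P := by
  induction P using Polynomial.induction_on' with
  | add p q hp hq =>
    simp only [map_add]
    rw [taylorSeries_add (hφ.aeval_polynomial p) (hφ.aeval_polynomial q), hp, hq]
  | monomial n a =>
    simp only [Polynomial.aeval_monomial]
    rw [taylorSeries_mul analyticAt_const (hφ.fun_pow n), taylorSeries_pow hφ, taylorSeries_const,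
      PowerSeries.algebraMap_apply]

/-- Cauchy's estimate; at radius `1` the bound does not depend on `n`. -/
theorem norm_coeff_taylorSeries_le {g : ℂ → ℂ} (hg : AnalyticOnNhd ℂ g (Metric.closedBall 0 1))
    {C : ℝ} (hC : ∀ z ∈ Metric.sphere (0 : ℂ) 1, ‖g z‖ ≤ C) (n : ℕ) :
    ‖PowerSeries.coeff n (taylorSeries g)‖ ≤ C := by
  have hd : DiffContOnCl ℂ g (Metric.ball 0 1) :=
    DifferentiableOn.diffContOnCl (by
      rw [closure_ball _ one_ne_zero]; exact hg.differentiableOn)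
  have := Complex.norm_iteratedDeriv_le_of_forall_mem_sphere_norm_le n one_pos hd hC
  have hn : (0 : ℝ) < n.factorial := by positivity
  rw [coeff_taylorSeries, norm_div, Complex.norm_natCast, div_le_iff₀ hn]
  simpa [mul_comm] using this

/-! ### Harmonic majorants on the circle -/

/-- A trigonometric polynomial is the sum of a polynomial in `z` and the conjugate of one. -/
theorem exists_polynomial_add_conj_eq {g : C(AddCircle (2 * Real.pi), ℂ)}
    (hg : g ∈ Submodule.span ℂ (Set.range (@fourier (2 * Real.pi)))) :
    ∃ P Q : Polynomial ℂ, ∀ t : ℝ,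
      g t = P.eval (circleMap 0 1 t) + (starRingEnd ℂ) (Q.eval (circleMap 0 1 t)) := by
  induction hg using Submodule.span_induction with
  | mem g h =>
    obtain ⟨n, rfl⟩ := h
    have hf : ∀ (k : ℕ) (t : ℝ), fourier (k : ℤ) (t : AddCircle (2 * Real.pi)) =
        circleMap 0 1 t ^ k := fun k t => by
      rw [fourier_coe_apply, circleMap_zero, Complex.ofReal_one, one_mul, ← Complex.exp_nat_mul]
      congr 1
      have : (Real.pi : ℂ) ≠ 0 := by exact_mod_cast Real.pi_ne_zero
      push_cast
      field_simp
    obtain ⟨k, rfl | rfl⟩ := n.eq_nat_or_neg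
    · exact ⟨Polynomial.X ^ k, 0, fun t => by rw [hf]; simp⟩
    · refine ⟨0, Polynomial.X ^ k, fun t => ?_⟩
      rw [fourier_neg, hf]
      simp
  | zero => exact ⟨0, 0, fun t => by simp⟩
  | add g h _ _ hg hh =>
    obtain ⟨P, Q, hP⟩ := hg
    obtain ⟨P', Q', hQ⟩ := hh
    exact ⟨P + P', Q + Q', fun t => by simp [hP, hQ]; ring⟩
  | smul c g _ hg =>
    obtain ⟨P, Q, hP⟩ := hg
    exact ⟨Polynomial.C c * P, Polynomial.C ((starRingEnd ℂ) c) * Q, fun t => by simp [hP]; ring⟩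

/-- A continuous function on the unit circle has a harmonic polynomial majorant whose mean is
arbitrarily close to that of the function. -/
theorem exists_polynomial_re_majorant {u : ℂ → ℝ} (hu : ContinuousOn u (Metric.sphere 0 1))
    {ε : ℝ} (hε : 0 < ε) :
    ∃ Q : Polynomial ℂ, (∀ z ∈ Metric.sphere (0 : ℂ) 1, u z ≤ (Q.eval z).re) ∧
      Real.circleAverage u 0 1 ≤ (Q.eval 0).re ∧ (Q.eval 0).re ≤ Real.circleAverage u 0 1 + ε := by
  have : Fact (0 < 2 * Real.pi) := ⟨Real.two_pi_pos⟩
  have hcont : Continuous fun x : AddCircle (2 * Real.pi) => ((u (AddCircle.toCircle x) : ℝ) : ℂ) :=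
    Complex.continuous_ofReal.comp <| hu.comp_continuous
      (continuous_subtype_val.comp AddCircle.continuous_toCircle)
      fun x => mem_sphere_zero_iff_norm.2 (Circle.norm_coe _)
  let g₀ : C(AddCircle (2 * Real.pi), ℂ) := ⟨_, hcont⟩
  have hg₀ : g₀ ∈ closure (Submodule.span ℂ (Set.range (@fourier (2 * Real.pi))) :
      Set C(AddCircle (2 * Real.pi), ℂ)) := by
    rw [← Submodule.topologicalClosure_coe, span_fourier_closure_eq_top]
    trivial
  obtain ⟨g, hg, hgd⟩ := Metric.mem_closure_iff.1 hg₀ (ε / 2) (by linarith)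
  obtain ⟨P, Q, hPQ⟩ := exists_polynomial_add_conj_eq hg
  have hclose : ∀ z ∈ Metric.sphere (0 : ℂ) 1, |u z - ((P + Q).eval z).re| ≤ ε / 2 := by
    intro z hz
    obtain ⟨t, -, rfl⟩ : z ∈ circleMap 0 1 '' Set.univ := by
      rw [Set.image_univ, range_circleMap]; simpa using hz
    have h1 : dist (g₀ t) (g t) ≤ ε / 2 := (ContinuousMap.dist_apply_le_dist _).trans hgd.le
    have h2 : g₀ t = ((u (circleMap 0 1 t) : ℝ) : ℂ) := by
      simp [g₀, AddCircle.toCircle_apply_mk, circleMap_zero]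
    rw [h2, hPQ, dist_eq_norm] at h1
    refine le_trans (le_of_eq ?_) ((Complex.abs_re_le_norm _).trans h1)
    simp
  -- Conjugation does not change real parts, so `P + Q` approximates `u` within `ε / 2`; adding `ε /
  -- 2` turns this into a majorant.
  set R : Polynomial ℂ := P + Q + Polynomial.C ((ε / 2 : ℝ) : ℂ) with hR
  have hR_re : ∀ z, (R.eval z).re = ((P + Q).eval z).re + ε / 2 := fun z => by
    rw [hR, Polynomial.eval_add, Polynomial.eval_C, Complex.add_re, Complex.ofReal_re]
  have hle : ∀ z ∈ Metric.sphere (0 : ℂ) 1, u z ≤ (R.eval z).re := fun z hz => by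
    have := (abs_le.1 (hclose z hz)).2
    rw [hR_re]
    linarith
  have hRi : CircleIntegrable (fun z => R.eval z) 0 1 :=
    R.continuous.continuousOn.circleIntegrable zero_le_one
  have hRi' : CircleIntegrable (fun z => (R.eval z).re) 0 1 :=
    (Complex.continuous_re.comp R.continuous).continuousOn.circleIntegrable zero_le_one
  have hmean : Real.circleAverage (fun z => (R.eval z).re) 0 1 = (R.eval 0).re := by
    have h1 := Complex.reCLM.circleAverage_comp_comm hRi
    rw [DiffContOnCl.circleAverage R.differentiable.diffContOnCl] at h1
    exact h1
  have hui : CircleIntegrable u 0 1 := hu.circleIntegrable zero_le_one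
  refine ⟨R, hle, ?_, ?_⟩
  · rw [← hmean]
    exact Real.circleAverage_mono hui hRi' (by rwa [abs_one])
  · rw [← hmean, ← Real.circleAverage_const ε 0 1, ← Real.circleAverage_fun_add hui
      (circleIntegrable_const _ _ _)]
    refine Real.circleAverage_mono hRi' (hui.add (circleIntegrable_const _ _ _)) ?_
    intro z hz
    rw [abs_one] at hz
    have := (abs_le.1 (hclose z hz)).1
    rw [hR_re]
    linarith

/-! ### Substitution of power series as a triangular transform -/

theorem coeff_pow_mul_eq_zero {R : Type*} [CommRing R] {a : R⟦X⟧}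
    (ha : PowerSeries.constantCoeff a = 0) (W : R⟦X⟧) {n l : ℕ} (h : n < l) :
    PowerSeries.coeff n (a ^ l * W) = 0 := by
  obtain ⟨c, rfl⟩ := PowerSeries.X_dvd_iff.2 ha
  rw [mul_pow, mul_assoc, PowerSeries.coeff_X_pow_mul', if_neg (by omega)]

theorem coeff_pow_mul_self {R : Type*} [CommRing R] {a : R⟦X⟧}
    (ha : PowerSeries.constantCoeff a = 0) (W : R⟦X⟧) (n : ℕ) :
    PowerSeries.coeff n (a ^ n * W) =
      PowerSeries.coeff 1 a ^ n * PowerSeries.constantCoeff W := by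
  obtain ⟨c, rfl⟩ := PowerSeries.X_dvd_iff.2 ha
  rw [mul_pow, mul_assoc, PowerSeries.coeff_X_pow_mul', if_pos le_rfl, Nat.sub_self]
  have : PowerSeries.coeff 1 (PowerSeries.X * c) = PowerSeries.constantCoeff c := by
    simp
  rw [this]
  simp

/-- As `a` has no constant term, `a ^ l` is divisible by `X ^ l`, so the sum stops at `l = n`. This
puts the substitutions of `x(t)` and of the weighted `φ` in the same triangular form. -/
theorem coeff_subst_mul {R : Type*} [CommRing R] [Algebra ℚ R] {a : R⟦X⟧}
    (ha : PowerSeries.constantCoeff a = 0) (W : R⟦X⟧) (f : ℚ⟦X⟧) (n : ℕ) :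
    PowerSeries.coeff n (PowerSeries.subst a f * W) =
      lowerTransform (fun n l => PowerSeries.coeff n (a ^ l * W))
        (fun l => algebraMap ℚ R (PowerSeries.coeff l f)) n := by
  have hs : PowerSeries.HasSubst a := PowerSeries.HasSubst.of_constantCoeff_zero' ha
  have h1 : ∀ i ≤ n, PowerSeries.coeff i (PowerSeries.subst a f) =
      ∑ l ∈ Finset.range (n + 1), PowerSeries.coeff l f • PowerSeries.coeff i (a ^ l) := by
    intro i hi
    rw [PowerSeries.coeff_subst' hs]
    refine finsum_eq_sum_of_support_subset _ fun l hl => ?_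
    by_contra h
    refine hl ?_
    have hil : i < l := by simp at h; omega
    have := coeff_pow_mul_eq_zero ha 1 hil
    rw [mul_one] at this
    simp [this]
  rw [PowerSeries.coeff_mul, lowerTransform]
  calc _ = ∑ x ∈ Finset.HasAntidiagonal.antidiagonal n, ∑ l ∈ Finset.range (n + 1),
        (PowerSeries.coeff l f • PowerSeries.coeff x.1 (a ^ l)) * PowerSeries.coeff x.2 W := by
        refine Finset.sum_congr rfl fun x hx => ?_
        have hx' : x.1 ≤ n := by simp at hx; omega
        rw [h1 x.1 hx', Finset.sum_mul]
    _ = _ := by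
        rw [Finset.sum_comm]
        refine Finset.sum_congr rfl fun l _ => ?_
        rw [PowerSeries.coeff_mul, Finset.sum_mul]
        refine Finset.sum_congr rfl fun x _ => ?_
        rw [Algebra.smul_def]
        ring

/-! ### Rational functions without pole at the origin -/

/-- The power series expansion at `0` of a rational function. -/
noncomputable def ratSeries (p : RatFunc ℚ) : ℚ⟦X⟧ :=
  (p.num : ℚ⟦X⟧) * (p.denom : ℚ⟦X⟧)⁻¹

theorem ratSeries_mul_denom {p : RatFunc ℚ} (hp0 : p.denom.eval 0 ≠ 0) :
    ratSeries p * (p.denom : ℚ⟦X⟧) = (p.num : ℚ⟦X⟧) := by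
  rw [ratSeries, mul_assoc, PowerSeries.inv_mul_cancel, mul_one]
  rwa [← PowerSeries.coeff_zero_eq_constantCoeff_apply, Polynomial.coeff_coe,
    Polynomial.coeff_zero_eq_eval_zero]

theorem coe_ratSeries {p : RatFunc ℚ} (hp0 : p.denom.eval 0 ≠ 0) :
    (ratSeries p : ℚ⸨X⸩) = (p : ℚ⸨X⸩) := by
  have h1 := congrArg (HahnSeries.ofPowerSeries ℤ ℚ) (ratSeries_mul_denom hp0)
  rw [map_mul] at h1
  rw [RatFunc.coe_coe, RatFunc.coe_coe] at h1
  have hd : ((algebraMap (Polynomial ℚ) (RatFunc ℚ) p.denom : RatFunc ℚ) : ℚ⸨X⸩) ≠ 0 :=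
    (map_ne_zero _).2 (RatFunc.algebraMap_ne_zero p.denom_ne_zero)
  refine mul_right_cancel₀ hd (h1.trans ?_)
  rw [← map_mul, ← (div_eq_iff (RatFunc.algebraMap_ne_zero p.denom_ne_zero)).1
    (RatFunc.num_div_denom p)]
  rfl

theorem subst_ratSeries_mul {R : Type*} [CommRing R] [Algebra ℚ R] {p : RatFunc ℚ}
    (hp0 : p.denom.eval 0 ≠ 0) {a : R⟦X⟧} (ha : PowerSeries.constantCoeff a = 0) :
    PowerSeries.subst a (ratSeries p) * Polynomial.aeval a p.denom = Polynomial.aeval a p.num := by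
  have hs : PowerSeries.HasSubst a := PowerSeries.HasSubst.of_constantCoeff_zero' ha
  rw [← PowerSeries.subst_coe hs, ← PowerSeries.subst_coe hs, ← ratSeries_mul_denom hp0,
    PowerSeries.subst_mul hs]

theorem aeval_denom_ne_zero {R : Type*} [CommRing R] [Nontrivial R] [Algebra ℚ R] {p : RatFunc ℚ}
    (hp0 : p.denom.eval 0 ≠ 0) {a : R⟦X⟧} (ha : PowerSeries.constantCoeff a = 0) :
    Polynomial.aeval a p.denom ≠ 0 := by
  intro h
  have h1 := congrArg (PowerSeries.constantCoeff (R := R)) h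
  rw [Polynomial.aeval_def, Polynomial.hom_eval₂, ha, map_zero, Polynomial.eval₂_at_zero] at h1
  rw [Polynomial.coeff_zero_eq_eval_zero] at h1
  rw [RingHom.comp_apply, PowerSeries.algebraMap_apply] at h1
  rw [PowerSeries.constantCoeff_C] at h1
  exact hp0 ((algebraMap ℚ R).injective (by rw [h1, map_zero]))

/-- Both sides agree after multiplication by the denominator, which is a nonzero series. Only the
germ at `0` matters, and there the denominator of `p` does not vanish along `φ`. -/
theorem taylorSeries_eval_ratFunc {p : RatFunc ℚ} (hp0 : p.denom.eval 0 ≠ 0) {φ : ℂ → ℂ}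
    (hφ : AnalyticAt ℂ φ 0) (hφ0 : φ 0 = 0)
    (hpφ : AnalyticAt ℂ (fun z => RatFunc.eval (algebraMap ℚ ℂ) (φ z) p) 0) :
    taylorSeries (fun z => RatFunc.eval (algebraMap ℚ ℂ) (φ z) p) =
      PowerSeries.subst (taylorSeries φ) (ratSeries p) := by
  have hc : PowerSeries.constantCoeff (taylorSeries φ) = 0 := by
    rw [constantCoeff_taylorSeries, hφ0]
  refine mul_right_cancel₀ (aeval_denom_ne_zero hp0 hc) ?_
  rw [subst_ratSeries_mul hp0 hc, ← taylorSeries_aeval hφ, ← taylorSeries_aeval hφ,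
    ← taylorSeries_mul hpφ (hφ.aeval_polynomial _)]
  refine taylorSeries_congr ?_
  have hne : Polynomial.aeval (φ 0) p.denom ≠ 0 := by
    rw [hφ0, Polynomial.aeval_def, Polynomial.eval₂_at_zero, Polynomial.coeff_zero_eq_eval_zero]
    simpa using hp0
  filter_upwards [(hφ.aeval_polynomial p.denom).continuousAt.eventually_ne hne] with z hz
  rw [RatFunc.eval]
  exact div_mul_cancel₀ _ hz

theorem subst_ratSeries_eq {p : RatFunc ℚ} (hp0 : p.denom.eval 0 ≠ 0) {x P : ℚ⟦X⟧}
    (hx : PowerSeries.constantCoeff x = 0)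
    (hP : (P : ℚ⸨X⸩) = RatFunc.eval (algebraMap ℚ ℚ⸨X⸩) (x : ℚ⸨X⸩) p) :
    PowerSeries.subst x (ratSeries p) = P := by
  have hd := aeval_denom_ne_zero hp0 hx
  refine mul_right_cancel₀ hd ?_
  rw [subst_ratSeries_mul hp0 hx]
  apply HahnSeries.ofPowerSeries_injective (Γ := ℤ)
  have hev : ∀ Q : Polynomial ℚ, Q.eval₂ (algebraMap ℚ ℚ⸨X⸩) (x : ℚ⸨X⸩) =
      HahnSeries.ofPowerSeries ℤ ℚ (Polynomial.aeval x Q) := fun Q => by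
    rw [Polynomial.aeval_def, Polynomial.hom_eval₂]
    congr 1
  rw [map_mul, hP, RatFunc.eval, hev, hev, div_mul_cancel₀]
  rwa [Ne, map_eq_zero_iff _ HahnSeries.ofPowerSeries_injective]

/-! ### Linear independence -/

theorem Transcendental.linearIndependent_powers {R A : Type*} [CommRing R] [CommRing A]
    [Algebra R A] {x : A} (hx : Transcendental R x) : LinearIndependent R fun k : ℕ => x ^ k := by
  have h := (Polynomial.basisMonomials R).linearIndependent.map' (Polynomial.aeval x).toLinearMap
    (LinearMap.ker_eq_bot.2 (transcendental_iff_injective.1 hx))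
  have he : (Polynomial.aeval x).toLinearMap ∘ Polynomial.basisMonomials R = fun k => x ^ k := by
    ext k
    simp [Polynomial.aeval_monomial]
  rwa [he] at h

/-- Ring homomorphisms out of `ℚ` are unique, so `ψ` respects whatever `ℚ`-algebra structures are
present. -/
theorem Transcendental.map_of_injective {R S : Type*} [CommRing R] [CommRing S] {_ : Algebra ℚ R}
    [Algebra ℚ S] {x : R} (hx : Transcendental ℚ x) {ψ : R →+* S} (hψ : Function.Injective ψ) :
    Transcendental ℚ (ψ x) := by
  rintro ⟨P, hP0, hP⟩
  refine hx ⟨P, hP0, hψ ?_⟩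
  rw [map_zero, ← hP, Polynomial.aeval_def, Polynomial.aeval_def, Polynomial.hom_eval₂]
  congr 1
  exact Subsingleton.elim _ _

/-- Independence in the tower `K ⊆ K(y) ⊆ L`: the powers of `y` are independent over `K` and lie in
`K(y)`, over which `g` is independent. -/
theorem linearIndependent_mul_pow_of_adjoin {K L ι : Type*} [Field K] [Field L] [Algebra K L]
    {y : L} (hy : Transcendental K y) {g : ι → L}
    (hg : LinearIndependent (IntermediateField.adjoin K {y}) g) :
    LinearIndependent K fun ik : ι × ℕ => g ik.1 * y ^ ik.2 := by
  let F := IntermediateField.adjoin K {y}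
  let y' : F := IntermediateField.AdjoinSimple.gen K y
  have hy' : Transcendental K y' := fun h => hy (h.algHom F.val)
  have h1 := (linearIndependent_smul hy'.linearIndependent_powers hg).comp Prod.swap
    Prod.swap_injective
  have he : (fun p : ℕ × ι => y' ^ p.1 • g p.2) ∘ Prod.swap =
      fun ik : ι × ℕ => g ik.1 * y ^ ik.2 := by
    ext ik
    exact mul_comm _ _
  rwa [he] at h1

theorem linearIndependent_of_ratMap {ι M N : Type*} [AddCommGroup M] [AddCommGroup N] [Module ℚ M]
    {_ : Module ℚ N} {b : ι → M} (ψ : M →+ N) (h : LinearIndependent ℚ fun i => ψ (b i)) :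
    LinearIndependent ℚ b :=
  LinearIndependent.of_comp ψ.toRatLinearMap h

theorem transcendental_coe_ratFunc {p : RatFunc ℚ}
    (hp : p ∉ Set.range (RatFunc.C : ℚ →+* RatFunc ℚ)) : Transcendental ℚ (p : ℚ⸨X⸩) :=
  (p.transcendental_of_ne_C fun ⟨c, hc⟩ => hp ⟨c, hc.symm⟩).map_of_injective (RingHom.injective _)

theorem linearIndependent_coeff_mul_pow {p : RatFunc ℚ}
    (hp : p ∉ Set.range (RatFunc.C : ℚ →+* RatFunc ℚ)) (hp0 : p.denom.eval 0 ≠ 0) {m : ℕ}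
    {f : Fin m → ℚ⟦X⟧}
    (hf : LinearIndependent (IntermediateField.adjoin ℚ {(p : ℚ⸨X⸩)}) (fun i => (f i : ℚ⸨X⸩))) :
    LinearIndependent ℚ (fun (ik : Fin m × ℕ) (n : ℕ) =>
      PowerSeries.coeff n (f ik.1 * ratSeries p ^ ik.2)) := by
  have h := linearIndependent_mul_pow_of_adjoin (transcendental_coe_ratFunc hp) hf
  obtain ⟨ψ, hψ⟩ : ∃ ψ : (ℕ → ℚ) →+ ℚ⸨X⸩, ∀ F : ℚ⟦X⟧,
      ψ (fun n => PowerSeries.coeff n F) = (F : ℚ⸨X⸩) := by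
    let mkHom : (ℕ → ℚ) →+ ℚ⟦X⟧ :=
      { toFun := PowerSeries.mk, map_zero' := rfl, map_add' := fun _ _ => rfl }
    refine ⟨(HahnSeries.ofPowerSeries ℤ ℚ).toAddMonoidHom.comp mkHom, fun F => ?_⟩
    have : mkHom (fun n => PowerSeries.coeff n F) = F := PowerSeries.ext fun n =>
      PowerSeries.coeff_mk n fun n => PowerSeries.coeff n F
    rw [AddMonoidHom.comp_apply, this]
    rfl
  have he : (fun ik : Fin m × ℕ => (f ik.1 : ℚ⸨X⸩) * (p : ℚ⸨X⸩) ^ ik.2) =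
      fun ik => ψ fun n => PowerSeries.coeff n (f ik.1 * ratSeries p ^ ik.2) := by
    ext1 ik
    rw [hψ, map_mul, map_pow, coe_ratSeries hp0]
  rw [he] at h
  exact linearIndependent_of_ratMap ψ h

/-! ### The holonomy bound -/

theorem HasIntegerCoeffs.mul {F G : ℚ⟦X⟧} (hF : HasIntegerCoeffs F) (hG : HasIntegerCoeffs G) :
    HasIntegerCoeffs (F * G) := by
  choose a ha using hF
  choose b hb using hG
  intro n
  refine ⟨∑ x ∈ Finset.HasAntidiagonal.antidiagonal n, a x.1 * b x.2, ?_⟩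
  rw [PowerSeries.coeff_mul]
  push_cast
  exact Finset.sum_congr rfl fun x _ => by rw [ha, hb]

theorem hasIntegerCoeffs_one : HasIntegerCoeffs 1 := fun n =>
  ⟨if n = 0 then 1 else 0, by rw [PowerSeries.coeff_one]; split_ifs <;> simp⟩

theorem HasIntegerCoeffs.pow {F : ℚ⟦X⟧} (hF : HasIntegerCoeffs F) (k : ℕ) :
    HasIntegerCoeffs (F ^ k) := by
  induction k with
  | zero => simpa using hasIntegerCoeffs_one
  | succ k ih => rw [pow_succ]; exact ih.mul hF

theorem IsHolomorphicOnClosedDisc.pow {F : ℂ⟦X⟧} (hF : IsHolomorphicOnClosedDisc F) (k : ℕ) :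
    IsHolomorphicOnClosedDisc (F ^ k) := by
  obtain ⟨g, hg, rfl⟩ := hF
  exact ⟨fun z => g z ^ k, hg.fun_pow k, taylorSeries_pow (hg 0 (by simp)) k⟩

/-- The positive part of the logarithm is needed because `k` may be less than `D`: `Re Q ≥ 0` allows
`k` to be replaced by `D` in the exponent. -/
theorem norm_pow_mul_exp_le_one {w Q : ℂ} (h : Real.posLog ‖w‖ ≤ Q.re) {k D : ℕ} (hk : k ≤ D) :
    ‖w ^ k * Complex.exp (-(D * Q))‖ ≤ 1 := by
  have h0 : 0 ≤ Q.re := Real.posLog_nonneg.trans h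
  have h1 : ‖w‖ ≤ Real.exp Q.re := by
    rcases (norm_nonneg w).eq_or_lt with hw | hw
    · rw [← hw]; positivity
    · rw [← Real.log_le_iff_le_exp hw]
      exact (le_max_right _ _).trans h
  rw [norm_mul, norm_pow, Complex.norm_exp]
  have h2 : (-(D * Q) : ℂ).re = -(D * Q.re) := by simp
  rw [h2, Real.exp_neg, ← div_eq_mul_inv, div_le_one (Real.exp_pos _), Real.exp_nat_mul]
  exact (pow_le_pow_left₀ (norm_nonneg _) h1 k).trans (pow_le_pow_right₀ (Real.one_le_exp h0) hk)

/-- The bound is kept separate from algebraicity because it is applied again to powers of a single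
series. -/
theorem card_le_of_linearIndependent
    (p : RatFunc ℚ) (hp : p ∉ Set.range (RatFunc.C : ℚ →+* RatFunc ℚ))
    (hp0 : p.denom.eval 0 ≠ 0)
    (x : ℚ⟦X⟧) (hx0 : PowerSeries.coeff 0 x = 0) (hx1 : PowerSeries.coeff 1 x = 1)
    (hpx : ∃ P : ℚ⟦X⟧, HasIntegerCoeffs P ∧
      (P : ℚ⸨X⸩) = RatFunc.eval (algebraMap ℚ ℚ⸨X⸩) (x : ℚ⸨X⸩) p)
    (φ : ℂ → ℂ) (hφ : AnalyticOnNhd ℂ φ (Metric.closedBall 0 1)) (hφ0 : φ 0 = 0)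
    (hφ1 : 1 < ‖deriv φ 0‖)
    (hpφ : AnalyticOnNhd ℂ (fun z => RatFunc.eval (algebraMap ℚ ℂ) (φ z) p)
      (Metric.closedBall 0 1))
    (m : ℕ) (f : Fin m → ℚ⟦X⟧)
    (hf : LinearIndependent (IntermediateField.adjoin ℚ {(p : ℚ⸨X⸩)})
      (fun i => (f i : ℚ⸨X⸩)))
    (hfx : ∀ i, HasIntegerCoeffs (PowerSeries.subst x (f i)))
    (hfφ : ∀ i, IsHolomorphicOnClosedDisc (PowerSeries.subst (taylorSeries φ) (f i))) :
    (m : ℝ) ≤ Real.exp 1 *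
      (Real.circleAverage (fun z => Real.posLog ‖RatFunc.eval (algebraMap ℚ ℂ) (φ z) p‖) 0 1 /
        Real.log ‖deriv φ 0‖) := by
  have h0mem : (0 : ℂ) ∈ Metric.closedBall (0 : ℂ) 1 := by simp
  set q : ℂ → ℂ := fun z => RatFunc.eval (algebraMap ℚ ℂ) (φ z) p with hq
  set avg : ℝ := Real.circleAverage (fun z => Real.posLog ‖q z‖) 0 1 with havg
  have hlog : 0 < Real.log ‖deriv φ 0‖ := Real.log_pos hφ1
  rw [mul_div_assoc', le_div_iff₀ hlog]
  refine le_of_forall_pos_le_add fun ε hε => ?_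
  have hucont : ContinuousOn (fun z => Real.posLog ‖q z‖) (Metric.sphere 0 1) :=
    Real.continuous_posLog.comp_continuousOn
      (hpφ.continuousOn.mono Metric.sphere_subset_closedBall).norm
  obtain ⟨Q, hQu, hQ0, hQε⟩ := exists_polynomial_re_majorant hucont
    (div_pos hε (Real.exp_pos 1))
  set v : ℝ := (Q.eval 0).re with hv
  have hv0 : 0 ≤ v :=
    (Real.circleAverage_nonneg_of_nonneg fun z _ => Real.posLog_nonneg).trans hQ0
  suffices h : m * Real.log ‖deriv φ 0‖ ≤ Real.exp 1 * v by
    refine h.trans ?_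
    calc Real.exp 1 * v ≤ Real.exp 1 * (avg + ε / Real.exp 1) := by gcongr
      _ = _ := by rw [mul_add, mul_div_cancel₀ _ (Real.exp_pos 1).ne']
  choose g hg hgφ using hfφ
  have hbdd : ∀ i, ∃ C, ∀ z ∈ Metric.sphere (0 : ℂ) 1, ‖g i z‖ ≤ C := fun i =>
    (isCompact_sphere (0 : ℂ) 1).exists_bound_of_continuousOn
      ((hg i).continuousOn.mono Metric.sphere_subset_closedBall)
  choose B hB using hbdd
  have hφc : PowerSeries.constantCoeff (taylorSeries φ) = 0 := by
    rw [constantCoeff_taylorSeries, hφ0]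
  have hφs := PowerSeries.HasSubst.of_constantCoeff_zero' hφc
  have hxc : PowerSeries.constantCoeff x = 0 := by simpa using hx0
  have hxs := PowerSeries.HasSubst.of_constantCoeff_zero' hxc
  let w : ℕ → ℂ → ℂ := fun D z => Complex.exp (-(D * Q.eval z))
  have hw : ∀ D, AnalyticOnNhd ℂ (w D) (Metric.closedBall 0 1) := fun D z _ => by
    have : AnalyticAt ℂ (fun z => Q.eval z) z := (Q.differentiable.analyticAt z)
    fun_prop
  -- Here `σ` is substitution of `x(t)` without weight and `τ D` is substitution of `φ` weighted by
  -- `w D`. The constant `C` bounds only the `g i`, hence is uniform in `D` and `k`.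
  refine card_mul_log_le (linearIndependent_coeff_mul_pow hp hp0 hf)
    (b := fun i k n => PowerSeries.coeff n (f i * ratSeries p ^ k))
    (σ := fun n l => PowerSeries.coeff n (x ^ l * 1)) (fun n => ?_) (fun i k n => ?_)
    (τ := fun D n l => PowerSeries.coeff n (taylorSeries φ ^ l * taylorSeries (w D)))
    hφ1 hv0 (fun D n => ?_) (C := ∑ i, |B i|) (fun D i k n hk => ?_)
  · rw [coeff_pow_mul_self hxc, hx1]
    simp
  · have h1 := coeff_subst_mul hxc 1 (f i * ratSeries p ^ k) n
    obtain ⟨P, hPint, hP⟩ := hpx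
    rw [mul_one, PowerSeries.subst_mul hxs, PowerSeries.subst_pow hxs,
      subst_ratSeries_eq hp0 hxc hP] at h1
    obtain ⟨z, hz⟩ := ((hfx i).mul (hPint.pow k)) n
    exact ⟨z, by rw [← hz, h1]; rfl⟩
  · rw [coeff_pow_mul_self hφc, norm_mul, norm_pow, constantCoeff_taylorSeries,
      coeff_taylorSeries, iteratedDeriv_one]
    simp only [w, Complex.norm_exp]
    simp [hv]
  · have h1 := coeff_subst_mul hφc (taylorSeries (w D)) (f i * ratSeries p ^ k) n
    have h0 : ∀ {F : ℂ → ℂ}, AnalyticOnNhd ℂ F (Metric.closedBall 0 1) → AnalyticAt ℂ F 0 :=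
      fun hF => hF 0 h0mem
    have hqk : AnalyticOnNhd ℂ (fun z => q z ^ k) (Metric.closedBall 0 1) := hpφ.fun_pow k
    rw [PowerSeries.subst_mul hφs, PowerSeries.subst_pow hφs, ← hgφ,
      ← taylorSeries_eval_ratFunc hp0 (h0 hφ) hφ0 (h0 hpφ), mul_assoc,
      ← taylorSeries_pow (h0 hpφ), ← taylorSeries_mul (h0 hqk) (h0 (hw D)),
      ← taylorSeries_mul (h0 (hg i)) ((h0 hqk).fun_mul (h0 (hw D)))] at h1
    have h2 : ‖PowerSeries.coeff n (taylorSeries fun z => g i z * (q z ^ k * w D z))‖ ≤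
        ∑ i, |B i| := by
      refine norm_coeff_taylorSeries_le (fun z hz => (hg i z hz).fun_mul
        ((hqk z hz).fun_mul (hw D z hz))) (fun z hz => ?_) n
      rw [norm_mul]
      calc ‖g i z‖ * ‖q z ^ k * w D z‖ ≤ ‖g i z‖ * 1 := by
            gcongr
            exact norm_pow_mul_exp_le_one (hQu z hz) hk.le
        _ ≤ |B i| := by rw [mul_one]; exact (hB i z hz).trans (le_abs_self _)
        _ ≤ ∑ i, |B i| :=
            Finset.single_le_sum (f := fun i => |B i|) (fun _ _ => abs_nonneg _) (Finset.mem_univ i)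
    rw [h1] at h2
    exact h2

/-! ### The inclusion of `ℚ(p)` in `ℚ(x)`, and the main theorem -/

theorem coe_polynomial_mem_adjoin_X (Q : Polynomial ℚ) : ((Q : ℚ⟦X⟧) : ℚ⸨X⸩) ∈
    IntermediateField.adjoin ℚ {((PowerSeries.X : ℚ⟦X⟧) : ℚ⸨X⸩)} := by
  induction Q using Polynomial.induction_on' with
  | add P Q hP hQ => rw [Polynomial.coe_add, map_add]; exact add_mem hP hQ
  | monomial n a =>
    rw [← Polynomial.C_mul_X_pow_eq_monomial, Polynomial.coe_mul, Polynomial.coe_pow,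
      Polynomial.coe_X, Polynomial.coe_C, map_mul, map_pow]
    refine mul_mem ?_ (pow_mem (IntermediateField.mem_adjoin_simple_self _ _) n)
    have : HahnSeries.ofPowerSeries ℤ ℚ (PowerSeries.C a) = algebraMap ℚ ℚ⸨X⸩ a :=
      DFunLike.congr_fun (Subsingleton.elim
        ((HahnSeries.ofPowerSeries ℤ ℚ).comp (PowerSeries.C (R := ℚ))) (algebraMap ℚ ℚ⸨X⸩)) a
    rw [this]
    exact IntermediateField.algebraMap_mem _ a

theorem coe_ratFunc_mem_adjoin_X (p : RatFunc ℚ) : (p : ℚ⸨X⸩) ∈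
    IntermediateField.adjoin ℚ {((PowerSeries.X : ℚ⟦X⟧) : ℚ⸨X⸩)} := by
  have h : (p : ℚ⸨X⸩) = ((p.num : ℚ⟦X⟧) : ℚ⸨X⸩) / ((p.denom : ℚ⟦X⟧) : ℚ⸨X⸩) := by
    rw [RatFunc.coe_coe, RatFunc.coe_coe, ← map_div₀]
    exact congrArg _ (RatFunc.num_div_denom p).symm
  rw [h]
  exact div_mem (coe_polynomial_mem_adjoin_X _) (coe_polynomial_mem_adjoin_X _)

theorem theorem2p1
    -- a nonconstant rational function without pole at `0`
    (p : RatFunc ℚ) (hp : p ∉ Set.range (RatFunc.C : ℚ →+* RatFunc ℚ))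
    (hp0 : p.denom.eval 0 ≠ 0)
    -- `x(t) ∈ t + t²ℚ⟦t⟧` with `p(x(t)) ∈ ℤ⟦t⟧`, where `p(x(t))` is evaluated in the field `ℚ⸨t⸩`
    (x : ℚ⟦X⟧) (hx0 : PowerSeries.coeff 0 x = 0) (hx1 : PowerSeries.coeff 1 x = 1)
    (hpx : ∃ P : ℚ⟦X⟧, HasIntegerCoeffs P ∧
      (P : ℚ⸨X⸩) = RatFunc.eval (algebraMap ℚ ℚ⸨X⸩) (x : ℚ⸨X⸩) p)
    -- `φ`, holomorphic near the closed unit disc, with `p ∘ φ` holomorphic there as well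
    -- (analyticity forces `φ` to avoid the poles of `p`)
    (φ : ℂ → ℂ) (hφ : AnalyticOnNhd ℂ φ (Metric.closedBall 0 1)) (hφ0 : φ 0 = 0)
    (hφ1 : 1 < ‖deriv φ 0‖)
    (hpφ : AnalyticOnNhd ℂ (fun z => RatFunc.eval (algebraMap ℚ ℂ) (φ z) p)
      (Metric.closedBall 0 1))
    -- `f₁, …, f_m`, linearly independent over the field `ℚ(p(x)) ⊆ ℚ⸨x⸩`
    (m : ℕ) (f : Fin m → ℚ⟦X⟧)
    (hf : LinearIndependent (IntermediateField.adjoin ℚ {(p : ℚ⸨X⸩)})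
      (fun i => (f i : ℚ⸨X⸩)))
    (hfx : ∀ i, HasIntegerCoeffs (PowerSeries.subst x (f i)))
    (hfφ : ∀ i, IsHolomorphicOnClosedDisc (PowerSeries.subst (taylorSeries φ) (f i))) :
    -- algebraicity over the field `ℚ(x) ⊆ ℚ⸨x⸩`, and the bound on `m`
    (∀ i, IsAlgebraic (IntermediateField.adjoin ℚ {((PowerSeries.X : ℚ⟦X⟧) : ℚ⸨X⸩)})
        (f i : ℚ⸨X⸩)) ∧
      (m : ℝ) ≤ Real.exp 1 *
        (Real.circleAverage (fun z => Real.posLog ‖RatFunc.eval (algebraMap ℚ ℂ) (φ z) p‖) 0 1 /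
          Real.log ‖deriv φ 0‖) := by
  refine ⟨fun i => ?_, card_le_of_linearIndependent p hp hp0 x hx0 hx1 hpx φ hφ hφ0 hφ1 hpφ m f hf
    hfx hfφ⟩
  have hφs : PowerSeries.HasSubst (taylorSeries φ) :=
    PowerSeries.HasSubst.of_constantCoeff_zero' (by rw [constantCoeff_taylorSeries, hφ0])
  have hxs : PowerSeries.HasSubst x :=
    PowerSeries.HasSubst.of_constantCoeff_zero' (by simpa using hx0)
  have halg : IsAlgebraic (IntermediateField.adjoin ℚ {(p : ℚ⸨X⸩)}) (f i : ℚ⸨X⸩) := by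
    by_contra htr
    -- The bound does not involve the functions, and powers of `f i` inherit integrality and
    -- holomorphy, so too many independent powers contradict it.
    obtain ⟨M, hM⟩ := exists_nat_gt (Real.exp 1 *
      (Real.circleAverage (fun z => Real.posLog ‖RatFunc.eval (algebraMap ℚ ℂ) (φ z) p‖) 0 1 /
        Real.log ‖deriv φ 0‖))
    refine hM.not_ge (card_le_of_linearIndependent p hp hp0 x hx0 hx1 hpx φ hφ hφ0 hφ1 hpφ M
      (fun k => f i ^ (k : ℕ)) ?_ (fun k => ?_) (fun k => ?_))
    · have h := (Transcendental.linearIndependent_powers htr).comp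
        (fun k : Fin M => (k : ℕ)) Fin.val_injective
      simp only [map_pow]
      exact h
    · rw [PowerSeries.subst_pow hxs]
      exact (hfx i).pow k
    · rw [PowerSeries.subst_pow hφs]
      exact (hfφ i).pow k
  refine IsAlgebraic.tower_top_of_subalgebra_le ?_ halg
  exact IntermediateField.adjoin_simple_le_iff.2 (coe_ratFunc_mem_adjoin_X p)
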